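/- **Theorem.** A CNF formula is a finite set of clauses, a clause is a finite set of literals, and the size $|\varphi|$ of a CNF formula $\varphi$ is its number of clauses. For $n\ge 1$ let $\psi_n$ be the CNF formula on the $3n$ variables $x_1,\dots,x_n,a_1,\dots,a_n,b_1,\dots,b_n$ given by $$ \begin{aligned} \psi_n={}&\bigwedge_{i=1}^{n-1}(\neg a_i\vee \neg x_i\vee x_{i+1})(\neg a_i\vee x_i\vee \neg x_{i+1})(\neg b_i\vee \neg x_i\vee x_{i+1})(\neg b_i\vee x_i\vee \neg x_{i+1})\\ &\wedge(\neg a_n\vee \neg x_1\vee \neg x_n)(\neg a_n\vee x_1\vee x_n)(\neg b_n\vee \neg x_1\vee \neg x_n)(\neg b_n\vee x_1\vee x_n), \end{aligned} $$ that is, $\bigwedge_{i=1}^{n-1}[(a_i\vee b_i)\Rightarrow(x_i\Leftrightarrow x_{i+1})]\wedge[(a_n\vee b_n)\Rightarrow(x_1\Leftrightarrow\neg x_n)]$. Write $\varphi\vdash_1 C$ if the clause $C$ can be derived from $\varphi$ by repeatedly deriving $D\setminus\{l\}$ from a clause $D\ni l$ and the unit clause $\neg l$. A partial assignment $\alpha$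 is a set of literals on the variables of $\varphi$ without a complementary pair, and $\varphi\wedge\alpha$ is $\varphi$ with the literals of $\alpha$ added as unit clauses. The formula $\varphi$ is *unit refutation complete* (URC) if, for every partial assignment $\alpha$, $\varphi\wedge\alpha\models\bot$ implies $\varphi\wedge\alpha\vdash_1\bot$. It is *propagation complete* (PC) if, for every partial assignment $\alpha$ and every literal $l$ on its variables, $\varphi\wedge\alpha\models l$ implies $\varphi\wedge\alpha\vdash_1 l$ or $\varphi\wedge\alpha\vdash_1\bot$. It is *q-Horn* if there are weights $\gamma(l)\in\{0,\tfrac12,1\}$ of its literals with $\gamma(l)+\gamma(\neg l)=1$ for every literal $l$ and $\sum_{l\in C}\gamma(l)\le 1$ for every clause $C\in\varphi$. A PC (URC) *encoding* of a formula $\psi(\mathbf{z})$ is a PC (URC) formula $\theta(\mathbf{z},\mathbf{y})$, possibly with auxiliary variables $\mathbf{y}$, such that an assignment $\mathbf{c}$ of $\mathbf{z}$ satisfies $\psi$ if and only if $\theta(\mathbf{c},\mathbf{d})$ holds for some assignment $\mathbf{d}$ of $\mathbf{y}$. Then there is an absolute constant $K$ such that, for every $n\ge 1$: - $\psi_n$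 is q-Horn and $|\psi_n|\le Kn$; - every URC formula on the variables of $\psi_n$ that is equivalent to $\psi_n$ has size at least $2^n$; - there is a PC, and hence URC, encoding of $\psi_n$ of size at most $Kn$. -/

import Mathlib

namespace PropLogic

/-! ### Literals, clauses, CNF formulas -/

/-- A literal on the variables `V`: `(v, true)` is the positive literal `v`
and `(v, false)` is the negative literal `¬ v`. -/
abbrev Literal (V : Type*) := V × Bool

/-- The complementary literal. -/
def Literal.neg {V : Type*} (l : Literal V) : Literal V := (l.1, !l.2)

/-- A clause is a (finite) set of literals, understood as their disjunction. -/
abbrev Clause (V : Type*) := Finset (Literal V)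

/-- A CNF formula is a (finite) set of clauses, understood as their conjunction. -/
abbrev CNF (V : Type*) := Finset (Clause V)

section Semantics

variable {V : Type*}

/-- The total assignment `τ` satisfies the literal `l`. -/
def Literal.Sat (τ : V → Bool) (l : Literal V) : Prop := τ l.1 = l.2

/-- The total assignment `τ` satisfies the clause `C`. -/
def Clause.Sat (τ : V → Bool) (C : Clause V) : Prop := ∃ l ∈ C, Literal.Sat τ l

/-- The total assignment `τ` satisfies the formula `φ`, i.e. `φ(τ) = 1`. -/
def CNF.Sat (τ : V → Bool) (φ : CNF V) : Prop := ∀ C ∈ φ, Clause.Sat τ C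

/-- Two formulas on the same variables are equivalent if they represent the same function. -/
def CNF.Equivalent (φ ψ : CNF V) : Prop := ∀ τ : V → Bool, CNF.Sat τ φ ↔ CNF.Sat τ ψ

/-- `φ ⊨ l`. -/
def CNF.Entails (φ : CNF V) (l : Literal V) : Prop :=
  ∀ τ : V → Bool, CNF.Sat τ φ → Literal.Sat τ l

/-- `φ ⊨ ⊥`. -/
def CNF.Unsat (φ : CNF V) : Prop := ∀ τ : V → Bool, ¬ CNF.Sat τ φ

/-- The size `|φ|` of a CNF formula: its number of clauses. -/
def CNF.size (φ : CNF V) : ℕ := Finset.card φ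

end Semantics

/-! ### Unit resolution, URC and PC formulas -/

section UnitResolution

variable {V : Type*} [DecidableEq V]

/-- `φ ⊢₁ C`: the clause `C` can be derived from `φ` by unit resolution. -/
inductive CNF.UnitDerives (φ : CNF V) : Clause V → Prop
  | clause {C : Clause V} : C ∈ φ → CNF.UnitDerives φ C
  | resolve {C : Clause V} {l : Literal V} :
      CNF.UnitDerives φ C → l ∈ C → CNF.UnitDerives φ {l.neg} →
      CNF.UnitDerives φ (C.erase l)

/-- A set of literals is a partial assignment if it has no complementary pair. -/
def IsPartialAssignment (α : Finset (Literal V)) : Prop :=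
  ∀ l ∈ α, l.neg ∉ α

/-- The formula `φ ∧ α`: every literal of `α` is added to `φ` as a unit clause. -/
def CNF.conj (φ : CNF V) (α : Finset (Literal V)) : CNF V :=
  φ ∪ α.image (fun l => {l})

/-- Unit refutation complete formulas. -/
def CNF.IsURC (φ : CNF V) : Prop :=
  ∀ α : Finset (Literal V), IsPartialAssignment α →
    CNF.Unsat (CNF.conj φ α) → CNF.UnitDerives (CNF.conj φ α) ∅

/-- Propagation complete formulas. -/
def CNF.IsPC (φ : CNF V) : Prop :=
  ∀ α : Finset (Literal V), IsPartialAssignment α → ∀ l : Literal V,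
    CNF.Entails (CNF.conj φ α) l →
      CNF.UnitDerives (CNF.conj φ α) {l} ∨ CNF.UnitDerives (CNF.conj φ α) ∅

end UnitResolution

/-! ### q-Horn formulas and encodings -/

/-- A formula is q-Horn if its literals admit weights `γ` in `{0, 1/2, 1}` such that complementary
literals have total weight `1` and every clause has total weight at most `1`. -/
def CNF.IsQHorn {V : Type*} (φ : CNF V) : Prop :=
  ∃ γ : Literal V → ℚ,
    (∀ l, γ l = 0 ∨ γ l = 1 / 2 ∨ γ l = 1) ∧
    (∀ l, γ l + γ l.neg = 1) ∧
    ∀ C ∈ φ, ∑ l ∈ C, γ l ≤ 1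

/-- `θ(x, y)`, with input variables `x` in `V` and auxiliary variables `y` in `W`, is a
CNF encoding of the boolean function `f(x)`. -/
def CNF.IsEncodingOf {V W : Type*} (θ : CNF (V ⊕ W)) (f : (V → Bool) → Prop) : Prop :=
  ∀ τ : V → Bool, f τ ↔ ∃ σ : W → Bool, CNF.Sat (Sum.elim τ σ) θ

/-! ### The guarded cycle formula -/

/-- The `3n` variables `x_i`, `a_i`, `b_i`, with indices running over `Fin n`. -/
inductive CycleVar (n : ℕ) where
  | x (i : Fin n) : CycleVar n
  | a (i : Fin n) : CycleVar n
  | b (i : Fin n) : CycleVar n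
deriving DecidableEq

/-- The literal that follows `x_i` on the cycle: `x_{i+1}`, except that the last variable
is followed by the negation of the first one. -/
def nextLit {n : ℕ} (i : Fin n) : Literal (CycleVar n) :=
  if h : i.val + 1 < n then (CycleVar.x ⟨i.val + 1, h⟩, true)
  else (CycleVar.x ⟨0, i.pos⟩, false)

/-- The two clauses `¬ g ∨ ¬ u ∨ v` and `¬ g ∨ u ∨ ¬ v` of the implication `g → (u ↔ v)`. -/
def guardedEquiv {V : Type*} [DecidableEq V] (g : V) (u v : Literal V) : CNF V :=
  {{(g, false), u.neg, v}, {(g, false), u, v.neg}}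

/-- The formula `ψ_n`: the conjunction of `(a_i ∨ b_i) → (x_i ↔ x_{i+1})` for all `i` but the last,
and of `(a_n ∨ b_n) → (x_n ↔ ¬ x_1)`. -/
def psi (n : ℕ) : CNF (CycleVar n) :=
  Finset.univ.biUnion fun i : Fin n =>
    guardedEquiv (CycleVar.a i) (CycleVar.x i, true) (nextLit i) ∪
    guardedEquiv (CycleVar.b i) (CycleVar.x i, true) (nextLit i)

end PropLogic

/-!
The formula `psi n` says that each active index `i`, meaning that `a i` or `b i` holds, forces
`x i` to agree with the literal `nextLit i`. Going once around the cycle turns `x 0` into its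
negation, so in a model some index is inactive (`exists_inactive_of_sat_psi`); conversely, once one
index `j` is inactive, the assignments `cutAssign j ε` respect all the others
(`cutAssign_nextLit`). Both other parts of the proof rest on these two facts.

*Lower bound.* Let `s` choose one of `a i`, `b i` for every `i`. Making the chosen variables true
contradicts `psi n`, so a URC formula `φ` equivalent to `psi n` refutes them by unit resolution.
As long as no clause of `φ` has precisely the chosen variables as its negated `a`/`b`-variables,
unit resolution can only derive chosen variables and negations of the others: any further
propagation would come from a clause violated by a model built with `cutAssign`
(`mem_guess_of_falsified`). Hence `φ` has a separate clause for each of the `2 ^ n` choices `s`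
(`exists_clause_of_choice`).

*Encoding.* In `cycleEncoding n`, a new variable for each `i` is implied by `a i` and by `b i`,
takes over as the guard of the equivalence, and one long clause says that not all new
variables hold. For propagation completeness, take a consistent set `U` of literals closed under
unit propagation. Some new variable `j` is not asserted by `U`. Each asserted guard propagates
between the two ends of its equivalence, so either both ends are set by `U`, compatibly, or both
are free. Giving all free `x`-variables their values under `cutAssign j ε` therefore extends `U`
to a model, and the sign `ε`, together with the freedom to activate one further index, suffices to
falsify any literal outside `U` (`exists_model_not_sat`).
-/

namespace PropLogic

/-! ### Literals and unit resolution -/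

section General

variable {V : Type*}

theorem Literal.neg_neg (l : Literal V) : l.neg.neg = l := by
  simp [Literal.neg]

theorem Literal.sat_neg (τ : V → Bool) (l : Literal V) :
    Literal.Sat τ l.neg ↔ ¬ Literal.Sat τ l := by
  simp only [Literal.Sat, Literal.neg]
  cases τ l.1 <;> cases l.2 <;> simp

variable [DecidableEq V]

theorem sat_guardedEquiv (τ : V → Bool) (g : V) (u v : Literal V) :
    CNF.Sat τ (guardedEquiv g u v) ↔ (τ g = true → (Literal.Sat τ u ↔ Literal.Sat τ v)) := by
  have hg : Literal.Sat τ (g, false) ↔ ¬ τ g = true := by simp [Literal.Sat]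
  simp only [CNF.Sat, guardedEquiv, Finset.mem_insert, Finset.mem_singleton, forall_eq_or_imp,
    forall_eq, Clause.Sat, exists_eq_or_imp, exists_eq_left, Literal.sat_neg, hg]
  tauto

theorem CNF.sat_union (τ : V → Bool) (φ φ' : CNF V) :
    CNF.Sat τ (φ ∪ φ') ↔ CNF.Sat τ φ ∧ CNF.Sat τ φ' := by
  simp only [CNF.Sat, Finset.mem_union, or_imp, forall_and]

theorem CNF.sat_conj (τ : V → Bool) (φ : CNF V) (α : Finset (Literal V)) :
    CNF.Sat τ (CNF.conj φ α) ↔ CNF.Sat τ φ ∧ ∀ l ∈ α, Literal.Sat τ l := by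
  rw [CNF.conj, CNF.sat_union]
  refine and_congr_right fun _ => ?_
  simp only [CNF.Sat, Finset.forall_mem_image, Clause.Sat, Finset.mem_singleton, exists_eq_left]

theorem CNF.UnitDerives.sdiff {φ : CNF V} {C : Clause V} (hC : CNF.UnitDerives φ C)
    (S : Finset (Literal V)) (hS : S ⊆ C) (h : ∀ l ∈ S, CNF.UnitDerives φ {l.neg}) :
    CNF.UnitDerives φ (C \ S) := by
  induction S using Finset.induction_on with
  | empty => simpa using hC
  | insert l S hl ih =>
    rw [Finset.sdiff_insert]
    refine .resolve (ih (fun x hx => hS (Finset.mem_insert_of_mem hx))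
      fun x hx => h x (Finset.mem_insert_of_mem hx)) ?_ (h l (Finset.mem_insert_self _ _))
    exact Finset.mem_sdiff.2 ⟨hS (Finset.mem_insert_self _ _), hl⟩

theorem CNF.UnitDerives.empty_of_neg {φ : CNF V} {l : Literal V}
    (h : CNF.UnitDerives φ {l}) (h' : CNF.UnitDerives φ {l.neg}) : CNF.UnitDerives φ ∅ := by
  simpa using CNF.UnitDerives.resolve h (Finset.mem_singleton_self l) h'

theorem CNF.UnitDerives.unit {φ : CNF V} {C : Clause V} (hC : C ∈ φ) {l : Literal V} (hl : l ∈ C)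
    (h : ∀ l' ∈ C, l' ≠ l → CNF.UnitDerives φ {l'.neg}) : CNF.UnitDerives φ {l} := by
  have := (CNF.UnitDerives.clause hC).sdiff (C.erase l) (Finset.erase_subset _ _)
    fun l' hl' => h l' (Finset.mem_of_mem_erase hl') (Finset.ne_of_mem_erase hl')
  rwa [Finset.sdiff_erase hl, Finset.sdiff_self, insert_empty_eq] at this

theorem CNF.IsPC.isURC [Nonempty V] {φ : CNF V} (h : φ.IsPC) : φ.IsURC := by
  intro α hα hu
  obtain ⟨v⟩ := ‹Nonempty V›
  rcases h α hα (v, true) fun τ hτ => (hu τ hτ).elim with h1 | h1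
  · rcases h α hα (Literal.neg (v, true)) fun τ hτ => (hu τ hτ).elim with h2 | h2
    · exact h1.empty_of_neg h2
    · exact h2
  · exact h1

/-- The set `U` of literals is consistent and closed under unit propagation in `φ`. -/
structure CNF.IsUnitClosed (φ : CNF V) (U : Set (Literal V)) : Prop where
  consistent : ∀ l ∈ U, l.neg ∉ U
  closed : ∀ C ∈ φ, ∀ l ∈ C, (∀ l' ∈ C, l' ≠ l → l'.neg ∈ U) → l ∈ U

/-- Propagation completeness amounts to falsifying each literal outside a consistent set closed
under unit propagation by a model that extends this set. -/
theorem CNF.isPC_of_forall_isUnitClosed {φ : CNF V}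
    (h : ∀ U, φ.IsUnitClosed U → ∀ l ∉ U, ∃ τ, CNF.Sat τ φ ∧
      (∀ l' ∈ U, Literal.Sat τ l') ∧ ¬ Literal.Sat τ l) : φ.IsPC := by
  intro α _ l hl
  by_contra! hcon
  obtain ⟨τ, h1, h2, h3⟩ := h {l | CNF.UnitDerives (φ.conj α) {l}}
    ⟨fun l h h' => hcon.2 (h.empty_of_neg h'),
      fun C hC l hl h => .unit (Finset.mem_union_left _ hC) hl h⟩ l hcon.1
  refine h3 (hl τ ((CNF.sat_conj _ _ _).2 ⟨h1, fun l' hl' => h2 l' (.clause ?_)⟩))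
  exact Finset.mem_union_right _ (Finset.mem_image_of_mem _ hl')

/-- Unit propagation through one clause of three literals. -/
theorem CNF.IsUnitClosed.mem_of_triple {φ : CNF V} {U : Set (Literal V)} (hU : φ.IsUnitClosed U)
    {p q r : Literal V} (hC : ({p, q, r} : Clause V) ∈ φ) :
    (p.neg ∈ U → q.neg ∈ U → r ∈ U) ∧ (p.neg ∈ U → r.neg ∈ U → q ∈ U) ∧
      (q.neg ∈ U → r.neg ∈ U → p ∈ U) := by
  refine ⟨fun h1 h2 => hU.closed _ hC r (by simp) ?_, fun h1 h2 => hU.closed _ hC q (by simp) ?_,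
    fun h1 h2 => hU.closed _ hC p (by simp) ?_⟩ <;>
  · intro l' hl' hne
    simp only [Finset.mem_insert, Finset.mem_singleton] at hl'
    rcases hl' with rfl | rfl | rfl <;> first | assumption | exact absurd rfl hne

theorem card_guardedEquiv_le (g : V) (u v : Literal V) : (guardedEquiv g u v).card ≤ 2 :=
  Finset.card_le_two

end General

/-! ### The guarded cycle formula -/

section Cycle

variable {n : ℕ}

theorem sat_psi (τ : CycleVar n → Bool) :
    CNF.Sat τ (psi n) ↔ ∀ i, (τ (.a i) = true ∨ τ (.b i) = true) →
      (τ (.x i) = true ↔ Literal.Sat τ (nextLit i)) := by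
  have hx : ∀ i, Literal.Sat τ (CycleVar.x i, true) ↔ τ (.x i) = true := fun i => Iff.rfl
  have : CNF.Sat τ (psi n) ↔ ∀ i,
      CNF.Sat τ (guardedEquiv (CycleVar.a i) (CycleVar.x i, true) (nextLit i)) ∧
      CNF.Sat τ (guardedEquiv (CycleVar.b i) (CycleVar.x i, true) (nextLit i)) := by
    simp only [← CNF.sat_union]
    simp only [CNF.Sat, psi, Finset.mem_biUnion, Finset.mem_univ, true_and]
    exact ⟨fun h i C hC => h C ⟨i, hC⟩, fun h C ⟨i, hC⟩ => h i C hC⟩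
  rw [this]
  refine forall_congr' fun i => ?_
  rw [sat_guardedEquiv, sat_guardedEquiv, hx, or_imp]

/-- Not all links of the cycle can be respected, since its sign is odd. -/
theorem exists_not_link (hn : 1 ≤ n) (τ : CycleVar n → Bool) :
    ∃ i, ¬ (τ (.x i) = true ↔ Literal.Sat τ (nextLit i)) := by
  by_contra! h
  have key : ∀ k (hk : k < n), τ (.x ⟨k, hk⟩) = τ (.x ⟨0, hn⟩) := by
    intro k
    induction k with
    | zero => intro _; rfl
    | succ k ih =>
      intro hk
      have := h ⟨k, by omega⟩
      simp only [nextLit, hk, dif_pos, Literal.Sat] at this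
      rw [← ih (by omega), Bool.eq_iff_iff, this]
  have h1 := h ⟨n - 1, by omega⟩
  have h2 : ¬ (n - 1 + 1 < n) := by omega
  simp only [nextLit, h2, dif_neg, not_false_eq_true, Literal.Sat, key] at h1
  revert h1
  cases τ (.x ⟨0, hn⟩) <;> simp

theorem exists_inactive_of_sat_psi (hn : 1 ≤ n) {τ : CycleVar n → Bool}
    (h : CNF.Sat τ (psi n)) : ∃ i, τ (.a i) = false ∧ τ (.b i) = false := by
  obtain ⟨i, hi⟩ := exists_not_link hn τ
  have := mt ((sat_psi τ).1 h i) hi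
  exact ⟨i, by simpa [not_or] using this⟩

/-- The values of the `x`-variables that respect every link of the cycle except the one at `j`:
`ε` up to `j` and `!ε` beyond. -/
def cutAssign (j : Fin n) (ε : Bool) (k : Fin n) : Bool := xor ε (decide (j < k))

theorem cutAssign_nextLit {τ : CycleVar n → Bool} {j : Fin n} {ε : Bool}
    (hτ : ∀ k, τ (.x k) = cutAssign j ε k) {i : Fin n} (hij : i ≠ j) :
    τ (.x i) = true ↔ Literal.Sat τ (nextLit i) := by
  have hij' : i.val ≠ j.val := fun h => hij (Fin.ext h)
  unfold nextLit
  split_ifs with h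
  · have : j < i ↔ j < ⟨i.val + 1, h⟩ := by simp only [Fin.lt_def]; omega
    simp only [Literal.Sat, hτ, cutAssign, this]
  · have h1 : j < i := by rw [Fin.lt_def]; omega
    have h2 : ¬ j < ⟨0, i.pos⟩ := by simp [Fin.lt_def]
    simp only [Literal.Sat, hτ, cutAssign, h1, h2]
    cases ε <;> simp

theorem exists_cutAssign_eq (j k : Fin n) (s : Bool) : ∃ ε, cutAssign j ε k = s :=
  ⟨xor s (decide (j < k)), by simp [cutAssign]⟩

theorem exists_nextLit_eq (i : Fin n) : ∃ k s, nextLit i = (CycleVar.x k, s) := by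
  unfold nextLit
  split_ifs <;> exact ⟨_, _, rfl⟩

theorem isQHorn_psi (n : ℕ) : CNF.IsQHorn (psi n) := by
  let γ : Literal (CycleVar n) → ℚ := fun l => match l with
    | (.x _, _) => 1 / 2
    | (_, true) => 1
    | (_, false) => 0
  have h0 : ∀ l, 0 ≤ γ l := by rintro ⟨_ | _ | _, _ | _⟩ <;> norm_num [γ]
  have hsum : ∀ p q r : Literal (CycleVar n), γ p = 0 → γ q = 1 / 2 → γ r = 1 / 2 →
      ∑ l ∈ ({p, q, r} : Clause (CycleVar n)), γ l ≤ 1 := by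
    intro p q r hp hq hr
    -- Literals may coincide, as they do for `n = 1`, hence only an inequality.
    have hins : ∀ (l : Literal (CycleVar n)) (S : Clause (CycleVar n)),
        ∑ x ∈ insert l S, γ x ≤ γ l + ∑ x ∈ S, γ x := by
      intro l S
      by_cases hl : l ∈ S
      · rw [Finset.insert_eq_of_mem hl]
        linarith [h0 l]
      · rw [Finset.sum_insert hl]
    have h1 := hins p {q, r}
    have h2 := hins q {r}
    rw [Finset.sum_singleton] at h2
    linarith
  refine ⟨γ, ?_, ?_, ?_⟩
  · rintro ⟨_ | _ | _, _ | _⟩ <;> simp [γ]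
  · rintro ⟨_ | _ | _, _ | _⟩ <;> norm_num [γ, Literal.neg]
  · intro C hC
    simp only [psi, Finset.mem_biUnion, Finset.mem_univ, true_and, Finset.mem_union, guardedEquiv,
      Finset.mem_insert, Finset.mem_singleton] at hC
    obtain ⟨i, hC⟩ := hC
    obtain ⟨k, s, hk⟩ := exists_nextLit_eq i
    rw [hk] at hC
    rcases hC with (rfl | rfl) | (rfl | rfl) <;> exact hsum _ _ _ rfl rfl rfl

theorem size_psi_le (n : ℕ) : CNF.size (psi n) ≤ 4 * n := by
  refine (Finset.card_biUnion_le_card_mul _ _ 4 fun i _ => ?_).trans (by simp [mul_comm])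
  exact (Finset.card_union_le _ _).trans
    (add_le_add (card_guardedEquiv_le _ _ _) (card_guardedEquiv_le _ _ _))

/-! ### URC formulas equivalent to the cycle formula -/

/-- The guard of index `i` chosen by `s`. -/
def guard (s : Bool) (i : Fin n) : CycleVar n := if s then .a i else .b i

theorem guard_ne_x (s : Bool) (i k : Fin n) : guard s i ≠ .x k := by
  cases s <;> simp [guard]

theorem guard_inj {s t : Bool} {i k : Fin n} : guard s i = guard t k ↔ s = t ∧ i = k := by
  cases s <;> cases t <;> simp [guard]

theorem exists_eq_guard_or_x (v : CycleVar n) : (∃ t i, v = guard t i) ∨ ∃ k, v = .x k := by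
  cases v with
  | x k => exact .inr ⟨k, rfl⟩
  | a i => exact .inl ⟨true, i, rfl⟩
  | b i => exact .inl ⟨false, i, rfl⟩

/-- The guards chosen by `s` and the negations of the other guards. -/
def guess (s : Fin n → Bool) : Set (Literal (CycleVar n)) :=
  {l | ∃ t i, l = (guard t i, t == s i)}

theorem guard_mem_guess {s : Fin n → Bool} {t c : Bool} {i : Fin n} :
    ((guard t i, c) : Literal (CycleVar n)) ∈ guess s ↔ c = (t == s i) := by
  constructor
  · rintro ⟨t', i', h⟩
    rw [Prod.mk.injEq, guard_inj] at h
    obtain ⟨⟨rfl, rfl⟩, h⟩ := h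
    exact h
  · rintro rfl
    exact ⟨t, i, rfl⟩

/-- Let `C` be a consequence of `psi n` whose negated guards are not exactly those chosen by `s`.
If `guess s` falsifies all literals of `C` but `l`, then propagating `l` does not leave
`guess s`. -/
theorem mem_guess_of_falsified {s : Fin n → Bool} {C : Clause (CycleVar n)}
    (hC : ∀ τ, CNF.Sat τ (psi n) → Clause.Sat τ C)
    (hs : ¬ ∀ t i, (guard t i, false) ∈ C ↔ t = s i) {l : Literal (CycleVar n)}
    (h : ∀ l' ∈ C, l' ≠ l → l'.neg ∈ guess s) : l ∈ guess s := by
  by_contra hl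
  have h1 : ∀ t i, (guard t i, false) ∈ C → t = s i := by
    intro t i hmem
    by_contra hne
    by_cases heq : (guard t i, false) = l
    · exact hl (heq ▸ guard_mem_guess.2 (by simpa using hne))
    · have := guard_mem_guess.1 (h _ hmem heq)
      exact hne (by simpa using this)
  obtain ⟨j, hj⟩ : ∃ j, (guard (s j) j, false) ∉ C := by
    by_contra! hall
    exact hs fun t i => ⟨h1 t i, fun ht => ht ▸ hall i⟩
  obtain ⟨ε, hε⟩ : ∃ ε, ∀ k, l.1 = .x k → cutAssign j ε k = !l.2 := by
    rcases exists_eq_guard_or_x l.1 with ⟨t, i, h⟩ | ⟨k, hk⟩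
    · exact ⟨true, fun k hk => absurd (h.symm.trans hk) (guard_ne_x _ _ _)⟩
    · obtain ⟨ε, hε⟩ := exists_cutAssign_eq j k (!l.2)
      refine ⟨ε, fun k' hk' => ?_⟩
      cases hk.symm.trans hk'
      exact hε
  -- The model that follows `guess s`, except that the index `j` is inactive.
  let τ : CycleVar n → Bool := fun v => match v with
    | .x k => cutAssign j ε k
    | .a i => decide (i ≠ j) && s i
    | .b i => decide (i ≠ j) && !s i
  have hτ : ∀ t i, τ (guard t i) = (decide (i ≠ j) && (t == s i)) := by
    intro t i
    cases t <;> cases hsi : s i <;> simp [guard, τ, hsi]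
  have hsat : CNF.Sat τ (psi n) := by
    refine (sat_psi τ).2 fun i hi => cutAssign_nextLit (j := j) (ε := ε) (fun _ => rfl) ?_
    rintro rfl
    simp [τ] at hi
  obtain ⟨l', hl', hsl'⟩ := hC τ hsat
  have hviol : ∀ t i c, (guard t i, c) ∈ C → (guard t i, !c) ∈ guess s →
      τ (guard t i) = c → False := by
    intro t i c hmem hg hτc
    rw [guard_mem_guess] at hg
    rw [hτ, ← hg] at hτc
    obtain ⟨rfl, rfl⟩ : i = j ∧ c = false := by
      by_cases hij : i = j <;> cases c <;> simp [hij] at hτc ⊢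
    obtain rfl : t = s i := by simpa using hg
    exact hj hmem
  by_cases heq : l' = l
  · subst heq
    obtain ⟨v, c⟩ := l'
    rcases exists_eq_guard_or_x v with ⟨t, i, rfl⟩ | ⟨k, rfl⟩
    · refine hviol t i c hl' ?_ hsl'
      rw [guard_mem_guess] at hl ⊢
      cases c <;> simpa using hl
    · have h2 : cutAssign j ε k = !c := hε k rfl
      have h3 : cutAssign j ε k = c := hsl'
      rw [h2] at h3
      cases c <;> simp at h3
  · obtain ⟨v, c⟩ := l'
    have hg := h _ hl' heq
    obtain ⟨t, i, hti⟩ := id hg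
    obtain rfl : v = guard t i := congrArg Prod.fst hti
    exact hviol t i c hl' hg hsl'

/-- A URC formula equivalent to `psi n` has a clause that negates exactly the guards chosen by
`s`. -/
theorem exists_clause_of_choice (hn : 1 ≤ n) {φ : CNF (CycleVar n)}
    (heq : CNF.Equivalent φ (psi n)) (hurc : φ.IsURC) (s : Fin n → Bool) :
    ∃ C ∈ φ, ∀ t i, (guard t i, false) ∈ C ↔ t = s i := by
  by_contra! hno
  have hno' : ∀ C ∈ φ, ¬ ∀ t i, (guard t i, false) ∈ C ↔ t = s i := by
    intro C hC hall
    obtain ⟨t, i, h⟩ := hno C hC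
    have := hall t i
    tauto
  set α : Finset (Literal (CycleVar n)) := Finset.univ.image fun i => (guard (s i) i, true) with hα
  have hpart : IsPartialAssignment α := by
    intro l hl
    simp only [hα, Finset.mem_image, Finset.mem_univ, true_and] at hl ⊢
    obtain ⟨i, rfl⟩ := hl
    simp [Literal.neg]
  have hunsat : CNF.Unsat (φ.conj α) := by
    intro τ hτ
    rw [CNF.sat_conj] at hτ
    obtain ⟨i, ha, hb⟩ := exists_inactive_of_sat_psi hn ((heq τ).1 hτ.1)
    have h1 : τ (guard (s i) i) = true :=
      hτ.2 (guard (s i) i, true) (Finset.mem_image_of_mem _ (Finset.mem_univ i))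
    cases hsi : s i <;> simp [guard, hsi, ha, hb] at h1
  have himp : ∀ C ∈ φ, ∀ τ, CNF.Sat τ (psi n) → Clause.Sat τ C :=
    fun C hC τ hτ => (heq τ).2 hτ C hC
  have key : ∀ D, CNF.UnitDerives (φ.conj α) D → (∃ i, D = {(guard (s i) i, true)}) ∨
      ∃ C ∈ φ, ∀ l ∈ C, l ∉ D → l.neg ∈ guess s := by
    intro D hD
    induction hD with
    | clause hC =>
      rcases Finset.mem_union.1 hC with hC | hC
      · exact .inr ⟨_, hC, fun l h h' => absurd h h'⟩
      · left
        simp only [hα, Finset.mem_image, Finset.mem_univ, true_and] at hC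
        obtain ⟨_, ⟨i, rfl⟩, rfl⟩ := hC
        exact ⟨i, rfl⟩
    | @resolve D l _ hl _ ih ih' =>
      have hneg : l.neg ∈ guess s := by
        rcases ih' with ⟨i, hi⟩ | ⟨C, hC, h⟩
        · rw [Finset.singleton_inj.1 hi]
          exact guard_mem_guess.2 (by simp)
        · exact mem_guess_of_falsified (himp C hC) (hno' C hC) fun l' hl' hne =>
            h l' hl' (by simpa using hne)
      rcases ih with ⟨i, rfl⟩ | ⟨C, hC, h⟩
      · rw [Finset.mem_singleton.1 hl] at hneg
        have := guard_mem_guess.1 hneg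
        simp at this
      · refine .inr ⟨C, hC, fun l' hl' hmem => ?_⟩
        by_cases hll : l' = l
        · exact hll ▸ hneg
        · exact h l' hl' fun h' => hmem (Finset.mem_erase.2 ⟨hll, h'⟩)
  rcases key ∅ (hurc α hpart hunsat) with ⟨i, hi⟩ | ⟨C, hC, h⟩
  · exact absurd hi.symm (Finset.singleton_ne_empty _)
  · -- A falsified clause would also propagate an `x`-literal, and none lies in `guess s`.
    obtain ⟨t, i, hti⟩ := mem_guess_of_falsified (himp C hC) (hno' C hC)
      (l := (.x ⟨0, hn⟩, true)) fun l' hl' _ => h l' hl' (Finset.notMem_empty _)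
    exact guard_ne_x t i _ (congrArg Prod.fst hti).symm

theorem two_pow_le_size (hn : 1 ≤ n) {φ : CNF (CycleVar n)}
    (heq : CNF.Equivalent φ (psi n)) (hurc : φ.IsURC) : 2 ^ n ≤ φ.size := by
  choose f hf hfs using exists_clause_of_choice hn heq hurc
  have hinj : Function.Injective f := by
    intro s s' h
    funext i
    have := hfs s (s i) i
    rw [h, hfs s'] at this
    exact this.2 rfl
  calc 2 ^ n = (Finset.univ : Finset (Fin n → Bool)).card := by simp
    _ ≤ φ.size := Finset.card_le_card_of_injOn f (fun s _ => hf s) hinj.injOn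

/-! ### A propagation complete encoding of linear size -/

/-- `nextLit i` as a literal over the variables of the encoding. -/
def nextLitEnc (i : Fin n) : Literal (CycleVar n ⊕ Fin n) :=
  (Sum.inl (nextLit i).1, (nextLit i).2)

/-- The clauses of the encoding for the index `i`, with `inr i` standing for `a i ∨ b i`. -/
def linkEncoding (i : Fin n) : CNF (CycleVar n ⊕ Fin n) :=
  guardedEquiv (Sum.inr i) (Sum.inl (.x i), true) (nextLitEnc i) ∪
    {{(Sum.inl (.a i), false), (Sum.inr i, true)}, {(Sum.inl (.b i), false), (Sum.inr i, true)}}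

/-- The clause saying that some index is inactive. -/
def inactiveClause (n : ℕ) : Clause (CycleVar n ⊕ Fin n) :=
  Finset.univ.image fun i => (Sum.inr i, false)

/-- The encoding of `psi n` with one auxiliary variable for each index. -/
def cycleEncoding (n : ℕ) : CNF (CycleVar n ⊕ Fin n) :=
  insert (inactiveClause n) (Finset.univ.biUnion linkEncoding)

theorem size_cycleEncoding_le (hn : 1 ≤ n) : (cycleEncoding n).size ≤ 5 * n := by
  have h : (Finset.univ.biUnion (linkEncoding (n := n))).card ≤ n * 4 := by
    refine (Finset.card_biUnion_le_card_mul _ _ 4 fun i _ => ?_).trans (by simp)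
    exact (Finset.card_union_le _ _).trans
      (add_le_add (card_guardedEquiv_le _ _ _) Finset.card_le_two)
  have := Finset.card_insert_le (inactiveClause n) (Finset.univ.biUnion (linkEncoding (n := n)))
  unfold CNF.size cycleEncoding
  omega

theorem sat_cycleEncoding (τ : CycleVar n ⊕ Fin n → Bool) :
    CNF.Sat τ (cycleEncoding n) ↔ (∃ i, τ (.inr i) = false) ∧ ∀ i,
      (τ (.inr i) = true → (τ (.inl (.x i)) = true ↔ Literal.Sat τ (nextLitEnc i))) ∧
      (τ (.inl (.a i)) = true → τ (.inr i) = true) ∧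
      (τ (.inl (.b i)) = true → τ (.inr i) = true) := by
  have h1 : CNF.Sat τ (cycleEncoding n) ↔
      Clause.Sat τ (inactiveClause n) ∧ ∀ i, CNF.Sat τ (linkEncoding i) := by
    simp only [CNF.Sat, cycleEncoding, Finset.forall_mem_insert, Finset.mem_biUnion,
      Finset.mem_univ, true_and]
    exact and_congr_right fun _ =>
      ⟨fun h i C hC => h C ⟨i, hC⟩, fun h C ⟨i, hC⟩ => h i C hC⟩
  rw [h1]
  refine and_congr ?_ (forall_congr' fun i => ?_)
  · simp [Clause.Sat, inactiveClause, Literal.Sat]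
  · rw [linkEncoding, CNF.sat_union, sat_guardedEquiv]
    refine and_congr Iff.rfl ?_
    simp only [CNF.Sat, Clause.Sat, Literal.Sat, Finset.mem_insert, Finset.mem_singleton,
      forall_eq_or_imp, forall_eq, exists_eq_or_imp, exists_eq_left]
    cases τ (.inl (.a i)) <;> cases τ (.inl (.b i)) <;> simp

theorem isEncodingOf_cycleEncoding (hn : 1 ≤ n) :
    CNF.IsEncodingOf (cycleEncoding n) (fun τ => CNF.Sat τ (psi n)) := by
  intro τ
  simp only [sat_cycleEncoding, Sum.elim_inl, Sum.elim_inr]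
  constructor
  · intro h
    refine ⟨fun i => τ (.a i) || τ (.b i), ?_, fun i => ⟨fun hi => ?_, fun hi => ?_, fun hi => ?_⟩⟩
    · obtain ⟨i, hi⟩ := exists_inactive_of_sat_psi hn h
      exact ⟨i, by simp [hi]⟩
    · exact (sat_psi τ).1 h i (by simpa using hi)
    · simp [hi]
    · simp [hi]
  · rintro ⟨σ, -, h⟩
    exact (sat_psi τ).2 fun i hi => (h i).1 (hi.elim (h i).2.1 (h i).2.2)

theorem linkEncoding_subset (i : Fin n) : linkEncoding i ⊆ cycleEncoding n :=
  fun _ hC => Finset.mem_insert_of_mem (Finset.mem_biUnion.2 ⟨i, Finset.mem_univ i, hC⟩)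

end Cycle

section Propagation

variable {n : ℕ} {U : Set (Literal (CycleVar n ⊕ Fin n))}

/-- Unit propagation through an asserted link `u ↔ v`, where `u` is `x i` and `v` its successor
literal. -/
theorem link_propagation (hU : (cycleEncoding n).IsUnitClosed U) (i : Fin n)
    {u v : Literal (CycleVar n ⊕ Fin n)} (hu : u = (Sum.inl (.x i), true))
    (hv : v = nextLitEnc i) :
    ((Sum.inr i, true) ∈ U → (u ∈ U ↔ v ∈ U) ∧ (u.neg ∈ U ↔ v.neg ∈ U)) ∧
      ((Sum.inr i, false) ∉ U → ¬ (u ∈ U ∧ v.neg ∈ U) ∧ ¬ (u.neg ∈ U ∧ v ∈ U)) := by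
  have h1 := hU.mem_of_triple (p := (Sum.inr i, false)) (q := u.neg) (r := v)
    (linkEncoding_subset i (by simp [linkEncoding, guardedEquiv, hu, hv]))
  have h2 := hU.mem_of_triple (p := (Sum.inr i, false)) (q := u) (r := v.neg)
    (linkEncoding_subset i (by simp [linkEncoding, guardedEquiv, hu, hv]))
  rw [Literal.neg_neg] at h1 h2
  have h3 : Literal.neg (Sum.inr i, false) = ((Sum.inr i, true) : Literal (CycleVar n ⊕ Fin n)) :=
    rfl
  rw [h3] at h1 h2
  tauto

/-- Unit propagation through the clauses `a i → inr i` and `b i → inr i`. -/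
theorem guard_propagation (hU : (cycleEncoding n).IsUnitClosed U) (t : Bool) (i : Fin n) :
    ((Sum.inl (guard t i), true) ∈ U → (Sum.inr i, true) ∈ U) ∧
      ((Sum.inr i, false) ∈ U → (Sum.inl (guard t i), false) ∈ U) := by
  have hC : ({(Sum.inl (guard t i), false), (Sum.inr i, true)} : Clause (CycleVar n ⊕ Fin n)) ∈
      cycleEncoding n := linkEncoding_subset i (by cases t <;> simp [linkEncoding, guard])
  constructor
  · refine fun h => hU.closed _ hC _ (by simp) fun l' hl' hne => ?_
    obtain rfl | rfl : l' = _ ∨ l' = _ := by simpa using hl'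
    exacts [h, absurd rfl hne]
  · refine fun h => hU.closed _ hC _ (by simp) fun l' hl' hne => ?_
    obtain rfl | rfl : l' = _ ∨ l' = _ := by simpa using hl'
    exacts [absurd rfl hne, h]

/-- If `inr i` is not refuted, the long clause leaves another index that is not asserted. -/
theorem exists_ne_not_asserted (hU : (cycleEncoding n).IsUnitClosed U) {i : Fin n}
    (hi : (Sum.inr i, false) ∉ U) : ∃ j, i ≠ j ∧ (Sum.inr j, true) ∉ U := by
  by_contra! h
  refine hi (hU.closed (inactiveClause n) (Finset.mem_insert_self _ _) _
    (Finset.mem_image_of_mem _ (Finset.mem_univ i)) fun l' hl' hne => ?_)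
  simp only [inactiveClause, Finset.mem_image, Finset.mem_univ, true_and] at hl'
  obtain ⟨j, rfl⟩ := hl'
  exact h j fun hij => hne (hij ▸ rfl)

theorem exists_not_asserted (hn : 1 ≤ n) (hU : (cycleEncoding n).IsUnitClosed U) :
    ∃ j, (Sum.inr j, true) ∉ U := by
  by_cases h : (Sum.inr ⟨0, hn⟩, true) ∈ U
  · obtain ⟨j, -, hj⟩ := exists_ne_not_asserted hU (hU.consistent _ h)
    exact ⟨j, hj⟩
  · exact ⟨_, h⟩

/-- The default values: the `x`-variables follow `cutAssign j ε`, and the indices in `S` are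
active. -/
def defaultAssign (j : Fin n) (ε : Bool) (S : Finset (Fin n)) : CycleVar n ⊕ Fin n → Bool
  | .inl (.x k) => cutAssign j ε k
  | .inl (.a i) => decide (i ∈ S)
  | .inl (.b i) => decide (i ∈ S)
  | .inr i => decide (i ∈ S)

open Classical in
/-- The assignment that follows `U` where `U` decides a variable and `w` elsewhere. -/
noncomputable def overrideAssign {V : Type*} (U : Set (Literal V)) (w : V → Bool) (v : V) : Bool :=
  if (v, true) ∈ U then true else if (v, false) ∈ U then false else w v

theorem sat_override_of_mem {V : Type*} {U : Set (Literal V)} (hU : ∀ l ∈ U, l.neg ∉ U)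
    (w : V → Bool) {l : Literal V} (hl : l ∈ U) : Literal.Sat (overrideAssign U w) l := by
  obtain ⟨v, _ | _⟩ := l
  · have : (v, true) ∉ U := hU _ hl
    simp [Literal.Sat, overrideAssign, hl, this]
  · simp [Literal.Sat, overrideAssign, hl]

theorem sat_override_of_notMem {V : Type*} {U : Set (Literal V)} (w : V → Bool) {l : Literal V}
    (hl : l ∉ U) (hl' : l.neg ∉ U) : Literal.Sat (overrideAssign U w) l ↔ Literal.Sat w l := by
  obtain ⟨v, _ | _⟩ := l <;> simp only [Literal.neg, Bool.not_false, Bool.not_true] at hl' <;>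
    simp [Literal.Sat, overrideAssign, hl, hl']

/-- If `inr j` is not asserted, a link `i ≠ j` is respected as soon as both of its ends are set
compatibly by `U` or both are free. -/
theorem link_override (hU : ∀ l ∈ U, l.neg ∉ U) {j i : Fin n} (hij : i ≠ j)
    (ε : Bool) (S : Finset (Fin n)) {u v : Literal (CycleVar n ⊕ Fin n)}
    (hu : u = (Sum.inl (.x i), true)) (hv : v = nextLitEnc i)
    (h1 : u ∈ U ↔ v ∈ U) (h2 : u.neg ∈ U ↔ v.neg ∈ U) :
    Literal.Sat (overrideAssign U (defaultAssign j ε S)) u ↔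
      Literal.Sat (overrideAssign U (defaultAssign j ε S)) v := by
  by_cases h3 : u ∈ U
  · exact iff_of_true (sat_override_of_mem hU _ h3) (sat_override_of_mem hU _ (h1.1 h3))
  by_cases h4 : u.neg ∈ U
  · exact iff_of_false ((Literal.sat_neg _ _).1 (sat_override_of_mem hU _ h4))
      ((Literal.sat_neg _ _).1 (sat_override_of_mem hU _ (h2.1 h4)))
  rw [sat_override_of_notMem _ h3 h4,
    sat_override_of_notMem _ (mt h1.2 h3) (mt h2.2 h4), hu, hv]
  exact cutAssign_nextLit (τ := fun y => defaultAssign j ε S (.inl y)) (fun _ => rfl) hij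

/-- Overriding the default values by `U` yields a model if the additionally activated
indices are admissible. -/
theorem sat_override_cycleEncoding (hU : (cycleEncoding n).IsUnitClosed U) {j : Fin n}
    (hj : (Sum.inr j, true) ∉ U) (ε : Bool) (S : Finset (Fin n)) (hjS : j ∉ S)
    (hS : ∀ i ∈ S, (Sum.inr i, false) ∉ U ∧
      (Literal.Sat (overrideAssign U (defaultAssign j ε S)) (Sum.inl (.x i), true) ↔
        Literal.Sat (overrideAssign U (defaultAssign j ε S)) (nextLitEnc i))) :
    CNF.Sat (overrideAssign U (defaultAssign j ε S)) (cycleEncoding n) := by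
  have hguard : ∀ t i, overrideAssign U (defaultAssign j ε S) (.inl (guard t i)) = true →
      overrideAssign U (defaultAssign j ε S) (.inr i) = true := by
    intro t i h
    have hp := guard_propagation hU t i
    by_cases h1 : (Sum.inr i, true) ∈ U
    · simp [overrideAssign, h1]
    by_cases h2 : (Sum.inr i, false) ∈ U
    · simp [overrideAssign, mt hp.1 h1, hp.2 h2] at h
    by_cases h3 : (Sum.inl (guard t i), false) ∈ U
    · simp [overrideAssign, mt hp.1 h1, h3] at h
    have h4 : defaultAssign j ε S (.inl (guard t i)) = decide (i ∈ S) := by cases t <;> rfl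
    have h5 : defaultAssign j ε S (.inr i) = decide (i ∈ S) := rfl
    simpa [overrideAssign, h1, h2, h3, mt hp.1 h1, h4, h5] using h
  refine (sat_cycleEncoding _).2 ⟨⟨j, ?_⟩, fun i => ⟨fun hi => ?_, hguard true i, hguard false i⟩⟩
  · simp [overrideAssign, hj, defaultAssign, hjS]
  · by_cases h1 : (Sum.inr i, true) ∈ U
    · have := (link_propagation hU i rfl rfl).1 h1
      exact link_override hU.consistent (by rintro rfl; exact hj h1) ε S rfl rfl this.1 this.2
    · have hiS : i ∈ S := by
        by_contra hiS
        simp [overrideAssign, h1, defaultAssign, hiS] at hi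
      exact (hS i hiS).2

theorem exists_model_activating (hU : (cycleEncoding n).IsUnitClosed U) {i : Fin n}
    (hi : (Sum.inr i, false) ∉ U) : ∃ j ε,
      CNF.Sat (overrideAssign U (defaultAssign j ε {i})) (cycleEncoding n) := by
  obtain ⟨j, hij, hj⟩ := exists_ne_not_asserted hU hi
  obtain ⟨u, hu⟩ : ∃ u : Literal (CycleVar n ⊕ Fin n), u = (Sum.inl (.x i), true) := ⟨_, rfl⟩
  obtain ⟨v, hv⟩ : ∃ v : Literal (CycleVar n ⊕ Fin n), v = nextLitEnc i := ⟨_, rfl⟩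
  suffices h : ∃ ε, Literal.Sat (overrideAssign U (defaultAssign j ε {i})) u ↔
      Literal.Sat (overrideAssign U (defaultAssign j ε {i})) v by
    obtain ⟨ε, hε⟩ := h
    refine ⟨j, ε, sat_override_cycleEncoding hU hj ε {i} (by simpa using hij.symm) ?_⟩
    intro i' hi'
    obtain rfl := Finset.mem_singleton.1 hi'
    exact ⟨hi, by rw [hu, hv] at hε; exact hε⟩
  have hp := (link_propagation hU i hu hv).2 hi
  -- If exactly one end of the link is free, `ε` is used to adapt it to the other end.
  have hmem : ∀ l ∈ U, ∀ ε, Literal.Sat (overrideAssign U (defaultAssign j ε {i})) l :=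
    fun l hl ε => sat_override_of_mem hU.consistent _ hl
  have hneg : ∀ l, l.neg ∈ U → ∀ ε, ¬ Literal.Sat (overrideAssign U (defaultAssign j ε {i})) l :=
    fun l hl ε => (Literal.sat_neg _ _).1 (hmem _ hl ε)
  have hfree : ∀ l, l ∉ U → l.neg ∉ U → (∃ k s, l = (Sum.inl (.x k), s)) →
      (∃ ε, Literal.Sat (overrideAssign U (defaultAssign j ε {i})) l) ∧
        ∃ ε, ¬ Literal.Sat (overrideAssign U (defaultAssign j ε {i})) l := by
    rintro l h1 h2 ⟨k, s, rfl⟩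
    simp only [sat_override_of_notMem _ h1 h2]
    obtain ⟨ε, hε⟩ := exists_cutAssign_eq j k s
    obtain ⟨ε', hε'⟩ := exists_cutAssign_eq j k (!s)
    exact ⟨⟨ε, hε⟩, ⟨ε', by simp [Literal.Sat, defaultAssign, hε']⟩⟩
  have hux : ∃ k s, u = (Sum.inl (.x k), s) := ⟨_, _, hu⟩
  have hvx : ∃ k s, v = (Sum.inl (.x k), s) := by
    obtain ⟨k, s, hks⟩ := exists_nextLit_eq i
    exact ⟨k, s, by rw [hv, nextLitEnc, hks]⟩
  by_cases u1 : u ∈ U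
  · by_cases v1 : v ∈ U
    · exact ⟨true, iff_of_true (hmem _ u1 _) (hmem _ v1 _)⟩
    · obtain ⟨ε, hε⟩ := (hfree v v1 (fun h => hp.1 ⟨u1, h⟩) hvx).1
      exact ⟨ε, iff_of_true (hmem _ u1 _) hε⟩
  by_cases u2 : u.neg ∈ U
  · by_cases v2 : v.neg ∈ U
    · exact ⟨true, iff_of_false (hneg _ u2 _) (hneg _ v2 _)⟩
    · obtain ⟨ε, hε⟩ := (hfree v (fun h => hp.2 ⟨u2, h⟩) v2 hvx).2
      exact ⟨ε, iff_of_false (hneg _ u2 _) hε⟩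
  by_cases v1 : v ∈ U
  · obtain ⟨ε, hε⟩ := (hfree u u1 u2 hux).1
    exact ⟨ε, iff_of_true hε (hmem _ v1 _)⟩
  by_cases v2 : v.neg ∈ U
  · obtain ⟨ε, hε⟩ := (hfree u u1 u2 hux).2
    exact ⟨ε, iff_of_false hε (hneg _ v2 _)⟩
  exact ⟨true, link_override hU.consistent hij true {i} hu hv
    (iff_of_false u1 v1) (iff_of_false u2 v2)⟩

theorem exists_model_not_sat (hn : 1 ≤ n) (hU : (cycleEncoding n).IsUnitClosed U)
    (l : Literal (CycleVar n ⊕ Fin n)) (hl : l ∉ U) :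
    ∃ τ, CNF.Sat τ (cycleEncoding n) ∧ (∀ l' ∈ U, Literal.Sat τ l') ∧ ¬ Literal.Sat τ l := by
  suffices h : ∃ w, CNF.Sat (overrideAssign U w) (cycleEncoding n) ∧
      (l.neg ∉ U → ¬ Literal.Sat w l) by
    obtain ⟨w, hw, hwl⟩ := h
    refine ⟨_, hw, fun l' hl' => sat_override_of_mem hU.consistent _ hl', ?_⟩
    by_cases hl' : l.neg ∈ U
    · exact (Literal.sat_neg _ _).1 (sat_override_of_mem hU.consistent _ hl')
    · rw [sat_override_of_notMem _ hl hl']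
      exact hwl hl'
  obtain ⟨j, hj⟩ := exists_not_asserted hn hU
  have hbase : ∀ ε, CNF.Sat (overrideAssign U (defaultAssign j ε ∅)) (cycleEncoding n) :=
    fun ε => sat_override_cycleEncoding hU hj ε ∅ (Finset.notMem_empty _)
      fun i hi => absurd hi (Finset.notMem_empty _)
  -- Without extra active indices, the free `a`-, `b`- and auxiliary variables are false, which
  -- leaves their negative literals to be falsified by activating an index.
  have hact : ∀ (i : Fin n) (y : CycleVar n ⊕ Fin n),
      (∀ j ε S, defaultAssign j ε S y = decide (i ∈ S)) →
      ((Sum.inr i, false) ∈ U → (y, false) ∈ U) → ∀ c, (y, c) ∉ U →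
      ∃ w, CNF.Sat (overrideAssign U w) (cycleEncoding n) ∧
        (Literal.neg (y, c) ∉ U → ¬ Literal.Sat w (y, c)) := by
    intro i y hy hprop c hc
    cases c with
    | true => exact ⟨_, hbase true, fun _ => by simp [Literal.Sat, hy]⟩
    | false =>
      obtain ⟨j', ε, h⟩ := exists_model_activating hU (mt hprop hc)
      exact ⟨_, h, fun _ => by simp [Literal.Sat, hy]⟩
  obtain ⟨(k | i | i) | i, c⟩ := l
  · obtain ⟨ε, hε⟩ := exists_cutAssign_eq j k (!c)
    exact ⟨_, hbase ε, fun _ => by simp [Literal.Sat, defaultAssign, hε]⟩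
  · exact hact i _ (fun _ _ _ => rfl) (guard_propagation hU true i).2 c hl
  · exact hact i _ (fun _ _ _ => rfl) (guard_propagation hU false i).2 c hl
  · exact hact i _ (fun _ _ _ => rfl) id c hl

theorem isPC_cycleEncoding (hn : 1 ≤ n) : (cycleEncoding n).IsPC :=
  CNF.isPC_of_forall_isUnitClosed fun _ hU l hl => exists_model_not_sat hn hU l hl

end Propagation

end PropLogic

theorem mainTheorem2 :
    ∃ K : ℕ, ∀ n : ℕ, 1 ≤ n →
      PropLogic.CNF.IsQHorn (PropLogic.psi n) ∧
      PropLogic.CNF.size (PropLogic.psi n) ≤ K * n ∧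
      (∀ φ : PropLogic.CNF (PropLogic.CycleVar n),
        PropLogic.CNF.Equivalent φ (PropLogic.psi n) → PropLogic.CNF.IsURC φ →
          2 ^ n ≤ PropLogic.CNF.size φ) ∧
      ∃ (m : ℕ) (θ : PropLogic.CNF (PropLogic.CycleVar n ⊕ Fin m)),
        PropLogic.CNF.IsEncodingOf θ (fun τ => PropLogic.CNF.Sat τ (PropLogic.psi n)) ∧
        PropLogic.CNF.IsPC θ ∧
        PropLogic.CNF.IsURC θ ∧
        PropLogic.CNF.size θ ≤ K * n := by
  refine ⟨5, fun n hn => ⟨PropLogic.isQHorn_psi n,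
    (PropLogic.size_psi_le n).trans (Nat.mul_le_mul_right n (by norm_num)),
    fun φ heq hurc => PropLogic.two_pow_le_size hn heq hurc, n, PropLogic.cycleEncoding n,
    PropLogic.isEncodingOf_cycleEncoding hn, PropLogic.isPC_cycleEncoding hn, ?_,
    PropLogic.size_cycleEncoding_le hn⟩⟩
  have : Nonempty (PropLogic.CycleVar n ⊕ Fin n) := ⟨.inr ⟨0, hn⟩⟩
  exact (PropLogic.isPC_cycleEncoding hn).isURC
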